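/- Equip $\mathbb{R}^2$ with the $l^\infty$ distance $d((x_1,y_1),(x_2,y_2))=\max(|x_1-x_2|,|y_1-y_2|)$ and let $X=C\cup L\subset\mathbb{R}^2$ with the restricted distance, where $C=\{(x,y): x\le -3|y|\}$ and $L=[0,\infty)\times\{0\}$. Let $\mathfrak m$ be the Borel measure on $X$ given by $$\mathfrak m=\frac{3}{-2x}\,\mathcal L^2|_{C}+\mathcal H^1|_{L},$$ where $\mathcal L^2$ is the Lebesgue measure and $\mathcal H^1$ the one-dimensional Hausdorff measure. Then $(X,d,\mathfrak m)$ is a complete separable geodesic metric space with a Borel measure for which every ball of positive radius has positive finite measure; it satisfies the measure contraction property $\mathsf{MCP}(0,3)$; it contains an isometrically embedded copy of $\mathbb{R}$; and it does not split topologically, i.e. there is no topological space $Y$ such that $X$ is homeomorphic to $\mathbb{R}\times Y$. Here a geodesic is a map $\gamma:[0,1]\to X$ with $d(\gamma_s,\gamma_t)=|s-t|\,d(\gamma_0,\gamma_1)$ for all $s,t\in[0,1]$; $\mathrm{Geo}(X)$ is the set of all geodesics with the topology of uniform convergence; $e_t(\gamma)=\gamma_t$; and $X$ is geodesic if any two points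 are joined by a geodesic. The property $\mathsf{MCP}(0,3)$ (in the sense of Ohta) means: for every $x\in X$ and every Borel set $A\subset X$ with $0<\mathfrak m(A)<\infty$ there is a Borel probability measure $\pi$ on $\mathrm{Geo}(X)$ such that $(e_0)_\sharp\pi=\delta_x$, $(e_1)_\sharp\pi=\mathfrak m(A)^{-1}\mathfrak m|_A$, and $(e_t)_\sharp\big(t^3\,\mathfrak m(A)\,\pi\big)\le\mathfrak m$ for all $t\in[0,1]$. In particular, there exists a complete geodesic metric measure space that satisfies $\mathsf{MCP}(0,3)$ and contains an isometric copy of $\mathbb{R}$ but does not split topologically. -/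

import Mathlib

open MeasureTheory

noncomputable section

/-! Geodesics of a metric space. -/

/-- `Geo X`: the constant speed minimizing geodesics `γ : [0,1] → X`, that is, the maps with
`d(γ s, γ t) = |s - t| d(γ 0, γ 1)`. (Such maps are automatically continuous; the topology is that
of uniform convergence.) -/
abbrev Geo (X : Type*) [MetricSpace X] : Type _ :=
  {γ : C(unitInterval, X) //
    ∀ s t : unitInterval, dist (γ s) (γ t) = |(s : ℝ) - (t : ℝ)| * dist (γ 0) (γ 1)}

/-- `Geo X` carries its Borel sigma-algebra. -/
instance Geo.instMeasurableSpace (X : Type*) [MetricSpace X] : MeasurableSpace (Geo X) :=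
  borel (Geo X)

instance Geo.instBorelSpace (X : Type*) [MetricSpace X] : BorelSpace (Geo X) := ⟨rfl⟩

/-- The evaluation map `e_t`. -/
def Geo.eval {X : Type*} [MetricSpace X] (t : unitInterval) (γ : Geo X) : X := γ.1 t

/-- The length of a geodesic. -/
def Geo.length {X : Type*} [MetricSpace X] (γ : Geo X) : ℝ := dist (γ.1 0) (γ.1 1)

/-- A space is geodesic if any two points are the end points of a geodesic. -/
def IsGeodesicSpace (X : Type*) [MetricSpace X] : Prop :=
  ∀ x y : X, ∃ γ : Geo X, Geo.eval 0 γ = x ∧ Geo.eval 1 γ = y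

/-! The measure contraction property. -/

/-- The function `s_K`. -/
def sK (K t : ℝ) : ℝ :=
  if 0 < K then Real.sin (√K * t) / √K
  else if K < 0 then Real.sinh (√(-K) * t) / √(-K)
  else t

/-- The distortion coefficient
`t (s_K(t d / √(N-1)) / s_K(d / √(N-1)))^(N-1)`; at `d = 0` the quotient is read as its limit `t`,
and the coefficient is `t` for `N = 1`. -/
def distortion (K N t d : ℝ) : ℝ :=
  if N = 1 then t
  else if d = 0 then t * t ^ (N - 1)
  else t * (sK K (t * d / √(N - 1)) / sK K (d / √(N - 1))) ^ (N - 1)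

/-- The measure contraction property `MCP(K,N)` in the sense of Ohta. -/
def MCP {X : Type*} [MetricSpace X] [MeasurableSpace X] [BorelSpace X]
    (K N : ℝ) (m : Measure X) : Prop :=
  (1 < N ∨ (N = 1 ∧ K ≤ 0)) ∧
  ∀ (x : X) (A : Set X), MeasurableSet A → 0 < m A → m A < ⊤ →
    (0 < K → A ⊆ Metric.ball x (Real.pi * √((N - 1) / K))) →
    ∃ P : Measure (Geo X), IsProbabilityMeasure P ∧
      P.map (Geo.eval 0) = Measure.dirac x ∧
      P.map (Geo.eval 1) = (m A)⁻¹ • m.restrict A ∧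
      ∀ t : unitInterval,
        ((m A) • P.withDensity
          (fun γ => ENNReal.ofReal (distortion K N t γ.length))).map (Geo.eval t) ≤ m

/-! Topological splitting. -/

/-- `X` splits topologically if it is homeomorphic to `ℝ × Y` for some topological space `Y`.
(Such a `Y` is homeomorphic to a subspace of `X`, so one may take it in the universe of `X`.) -/
def TopologicallySplits.{u} (X : Type u) [TopologicalSpace X] : Prop :=
  ∃ (Y : Type u) (_ : TopologicalSpace Y), Nonempty (X ≃ₜ ℝ × Y)

/-! The example. -/

/-- The planar cone `C = {(x, y) : x ≤ -3|y|}`. -/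
def planarCone : Set (ℝ × ℝ) := {p | p.1 ≤ -3 * |p.2|}

/-- The half-line `L = [0, ∞) × {0}`. -/
def halfLine : Set (ℝ × ℝ) := {p | 0 ≤ p.1 ∧ p.2 = 0}

/-- The space `X = C ∪ L`, with the metric of `ℝ × ℝ`, which is the `l^∞` metric. -/
abbrev ConeLine : Type := ↥(planarCone ∪ halfLine)

/-- The measure on the plane that is `3/(-2x)` times Lebesgue measure on `C` plus the
one-dimensional Hausdorff measure on `L`. -/
def planeMeasure : Measure (ℝ × ℝ) :=
  (volume.restrict planarCone).withDensity (fun p => ENNReal.ofReal (3 / (-2 * p.1)))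
    + (Measure.hausdorffMeasure 1).restrict halfLine

/-- The reference measure of `X`. -/
def coneLineMeasure : Measure ConeLine := planeMeasure.comap Subtype.val

end

/-! The slice of `C` at abscissa `x < 0` has length `-2x/3`, so the density gives it mass one. With
`η`, the height divided by the half-width of the slice, as second coordinate, the measure is the
image under `chart` of Lebesgue measure in `x` times the uniform probability in `η`; over `L` the
factor `η` collapses to a point.

For the `l^∞` metric, any path with affine abscissa whose ordinate varies no faster than its
abscissa is a geodesic, so there is freedom in moving `η`. Let `η` move from its initial to its
final value with a weight `f(x,t)`, where `x` is the final abscissa. The Jacobian of the time `t`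
map is `t f`, so `MCP(0,3)` follows from `f ≥ t²` (`map_contraction_le`).

From abscissa `a < 0`, straight segments have this property when `x ≤ a/2`, but for targets nearer
the apex their weight becomes too small. There the weight is frozen at its value `t/(2-t) ≥ t²` for
`x = a/2`. The path is no longer straight, but the narrow opening of the cone keeps its slope at
most one (`abs_height_sub_le_of_antitone`). From a point of `L`, the weight `1` works.

If `X` were `ℝ × Y`, then `Y` would be connected. A one-point `Y` would embed the cone in a line;
otherwise the product has no cut point, whereas `(1,0)` cuts `X`. -/

/-! ### Coordinates on the space -/

/-- The truncation of a real number to `[-1, 1]`. -/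
def clampOne (η : ℝ) : ℝ := max (-1) (min η 1)

theorem continuous_clampOne : Continuous clampOne := by unfold clampOne; fun_prop

theorem abs_clampOne_le (η : ℝ) : |clampOne η| ≤ 1 :=
  abs_le.2 ⟨le_max_left _ _, max_le (by norm_num) (min_le_right _ _)⟩

theorem clampOne_of_abs_le {η : ℝ} (h : |η| ≤ 1) : clampOne η = η := by
  rw [abs_le] at h
  rw [clampOne, min_eq_left h.2, max_eq_right h.1]

theorem chart_mem (p : ℝ × ℝ) :
    ((p.1, max (-p.1) 0 * clampOne p.2 / 3) : ℝ × ℝ) ∈ planarCone ∪ halfLine := by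
  rcases le_total p.1 0 with h | h
  · left
    have := abs_clampOne_le p.2
    simp only [planarCone, Set.mem_ofPred_eq, max_eq_left (neg_nonneg.2 h), abs_div, abs_mul,
      abs_of_nonneg (neg_nonneg.2 h), abs_of_pos (zero_lt_three (α := ℝ))]
    nlinarith
  · right
    simp [halfLine, h]

/-- The coordinates `(x, η)` on `ConeLine`: the abscissa, and the height relative to the half-width
of the slice of the cone at that abscissa. -/
noncomputable def chart (p : ℝ × ℝ) : ConeLine := ⟨(p.1, max (-p.1) 0 * clampOne p.2 / 3), chart_mem p⟩

theorem continuous_chart : Continuous chart := by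
  have := continuous_clampOne
  unfold chart
  fun_prop

theorem exists_chart_eq (q : ConeLine) : ∃ p : ℝ × ℝ, |p.2| ≤ 1 ∧ chart p = q := by
  obtain ⟨⟨x, y⟩, h⟩ := q
  rcases lt_or_ge x 0 with hx | hx
  · have hy : x ≤ -3 * |y| := by
      rcases h with h | h
      · exact h
      · exact absurd h.1 (not_le.2 hx)
    have h1 : |3 * y / -x| ≤ 1 := by
      rw [abs_div, abs_mul, abs_of_pos (neg_pos.2 hx), div_le_one (neg_pos.2 hx),
        abs_of_pos (zero_lt_three (α := ℝ))]
      linarith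
    refine ⟨(x, 3 * y / -x), h1, Subtype.ext (Prod.ext rfl ?_)⟩
    simp only [chart, clampOne_of_abs_le h1, max_eq_left (neg_pos.2 hx).le]
    rw [mul_div_cancel₀ _ (neg_pos.2 hx).ne', mul_div_cancel_left₀ _ (by norm_num)]
  · refine ⟨(x, 0), by simp, Subtype.ext (Prod.ext rfl ?_)⟩
    have hy : y = 0 := by
      rcases h with h | h
      · have h' : x ≤ -3 * |y| := h
        exact abs_eq_zero.1 (by linarith [abs_nonneg y])
      · exact h.2
    simp [chart, hx, hy]

/-! ### Metric, closedness and the embedded line -/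

theorem ConeLine.dist_eq (p q : ConeLine) :
    dist p q = max |p.1.1 - q.1.1| |p.1.2 - q.1.2| := by
  simp [Subtype.dist_eq, Prod.dist_eq, Real.dist_eq]

theorem isClosed_planarCone : IsClosed planarCone :=
  isClosed_le continuous_fst (by fun_prop)

theorem isClosed_halfLine : IsClosed halfLine :=
  (isClosed_le continuous_const continuous_fst).inter (isClosed_eq continuous_snd continuous_const)

theorem isClosed_coneLine : IsClosed (planarCone ∪ halfLine) :=
  isClosed_planarCone.union isClosed_halfLine

theorem exists_isometry_real_coneLine : ∃ f : ℝ → ConeLine, Isometry f := by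
  refine ⟨fun x => chart (x, 0), Isometry.of_dist_eq fun x y => ?_⟩
  simp [ConeLine.dist_eq, chart, clampOne, Real.dist_eq]

/-! ### Failure of topological splitting -/

instance : ConnectedSpace ConeLine :=
  Function.Surjective.connectedSpace
    (fun q => let ⟨p, hp⟩ := exists_chart_eq q; ⟨p, hp.2⟩) continuous_chart

/-- Two arcs of the cone with common end points and no other common point obstruct an embedding
into the line. -/
theorem not_injective_of_continuous_coneLine {g : ConeLine → ℝ} (hg : Continuous g) :
    ¬ Function.Injective g := by
  intro hinj
  -- A vertical segment and a wedge with vertex `(-4,0)`, meeting only at `(-3,±1)`. A value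
  -- strictly between those at the end points is taken on both arcs.
  let e : Set.Icc (-1 : ℝ) 1 → ConeLine := fun y => ⟨(-3, y), Or.inl (by
    have := abs_le.2 ⟨y.2.1, y.2.2⟩
    simp only [planarCone, Set.mem_ofPred_eq]; linarith)⟩
  let e' : Set.Icc (-1 : ℝ) 1 → ConeLine := fun y => ⟨(-4 + |(y : ℝ)|, y), Or.inl (by
    have := abs_le.2 ⟨y.2.1, y.2.2⟩
    simp only [planarCone, Set.mem_ofPred_eq]; linarith)⟩
  have he : Continuous e := by fun_prop
  have he' : Continuous e' := by fun_prop
  let a : Set.Icc (-1 : ℝ) 1 := ⟨-1, by norm_num⟩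
  let b : Set.Icc (-1 : ℝ) 1 := ⟨1, by norm_num⟩
  have ha : e' a = e a := Subtype.ext (Prod.ext (by norm_num [e, e', a]) rfl)
  have hb : e' b = e b := Subtype.ext (Prod.ext (by norm_num [e, e', b]) rfl)
  have hab : g (e a) ≠ g (e b) := fun h => by
    have := congrArg (fun q : ConeLine => q.1.2) (hinj h)
    norm_num [e, a, b] at this
  have hc : ∃ c ∈ Set.uIcc (g (e a)) (g (e b)), c ≠ g (e a) ∧ c ≠ g (e b) := by
    refine ⟨(g (e a) + g (e b)) / 2, ?_, fun h => hab (by linarith), fun h => hab (by linarith)⟩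
    rw [Set.mem_uIcc]
    rcases le_total (g (e a)) (g (e b)) with h | h
    · left; constructor <;> linarith
    · right; constructor <;> linarith
  obtain ⟨c, hc, hca, hcb⟩ := hc
  have : PreconnectedSpace (Set.Icc (-1 : ℝ) 1) := Subtype.preconnectedSpace isPreconnected_Icc
  have key : ∀ k : Set.Icc (-1 : ℝ) 1 → ℝ, Continuous k → k a = g (e a) → k b = g (e b) →
      ∃ y, k y = c := by
    intro k hk h1 h2
    rw [← h1, ← h2] at hc
    rcases Set.mem_uIcc.1 hc with h | h
    · exact intermediate_value_univ a b hk h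
    · exact intermediate_value_univ b a hk h
  obtain ⟨y, hy⟩ := key (g ∘ e) (hg.comp he) rfl rfl
  obtain ⟨z, hz⟩ := key (g ∘ e') (hg.comp he') (congrArg g ha) (congrArg g hb)
  have hyz := hinj (hy.trans hz.symm)
  have h1 : (-3 : ℝ) = -4 + |(z : ℝ)| := congrArg (fun q : ConeLine => q.1.1) hyz
  rcases (abs_eq zero_le_one).1 (show |(z : ℝ)| = 1 by linarith) with h | h
  · have : z = b := Subtype.ext h
    exact hcb (by rw [← hz, this]; exact congrArg g hb)
  · have : z = a := Subtype.ext h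
    exact hca (by rw [← hz, this]; exact congrArg g ha)

theorem pos_iff_of_ne_zero {Z : Type*} [TopologicalSpace Z] [PreconnectedSpace Z] {k : Z → ℝ}
    (hk : Continuous k) (h0 : ∀ z, k z ≠ 0) (z w : Z) : 0 < k z ↔ 0 < k w := by
  have key : ∀ z w : Z, 0 < k z → 0 < k w := by
    intro z w hz
    by_contra hw
    obtain ⟨u, hu⟩ := intermediate_value_univ w z hk ⟨not_lt.1 hw, hz.le⟩
    exact h0 u hu
  exact ⟨key z w, key w z⟩

/-- A product of the line with a connected space having at least two points has no cut point. -/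
theorem pos_iff_of_prod {Y : Type*} [TopologicalSpace Y] [PreconnectedSpace Y] [Nontrivial Y]
    {k : ℝ × Y → ℝ} (hk : Continuous k) {p : ℝ × Y} (h0 : ∀ q, k q = 0 → q = p)
    {q r : ℝ × Y} (hq : q ≠ p) (hr : r ≠ p) : 0 < k q ↔ 0 < k r := by
  obtain ⟨y, hy⟩ := exists_ne p.2
  have line : ∀ z, z ≠ p.2 → ∀ b c, 0 < k (b, z) ↔ 0 < k (c, z) := fun z hz b c =>
    pos_iff_of_ne_zero (k := fun b => k (b, z)) (by fun_prop)
      (fun b h => hz (congrArg Prod.snd (h0 _ h))) b c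
  have slice : ∀ b, b ≠ p.1 → ∀ z w, 0 < k (b, z) ↔ 0 < k (b, w) := fun b hb z w =>
    pos_iff_of_ne_zero (k := fun z => k (b, z)) (by fun_prop)
      (fun b h => hb (congrArg Prod.fst (h0 _ h))) z w
  -- Lines and slices that miss `p` join every other point to `(p.1, y)`; a point on the line
  -- through `p` first leaves it along its slice.
  have main : ∀ q, q ≠ p → (0 < k q ↔ 0 < k (p.1, y)) := by
    rintro ⟨b, z⟩ hq
    by_cases hz : z = p.2
    · have hb : b ≠ p.1 := fun hb => hq (Prod.ext hb hz)
      exact (slice b hb z y).trans (line y hy b p.1)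
    · exact (line z hz b (p.1 + 1)).trans
        ((slice (p.1 + 1) (by simp) z y).trans (line y hy _ _))
  exact (main q hq).trans (main r hr).symm

theorem not_topologicallySplits_coneLine : ¬ TopologicallySplits ConeLine := by
  rintro ⟨Y, _, ⟨h⟩⟩
  rcases subsingleton_or_nontrivial Y with hY | hY
  · refine not_injective_of_continuous_coneLine (g := fun q => (h q).1) (by fun_prop) ?_
    exact fun q r hqr => h.injective (Prod.ext hqr (Subsingleton.elim _ _))
  · have : PreconnectedSpace Y := by
      have : ConnectedSpace Y := Function.Surjective.connectedSpace (f := fun q => (h q).2)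
        (fun y => ⟨h.symm (0, y), by simp⟩) (by fun_prop)
      infer_instance
    let k : ConeLine → ℝ := fun q => q.1.1 - 1
    have hk : Continuous k := by fun_prop
    have h0 : ∀ q, k q = 0 → q = chart (1, 0) := by
      rintro q hq
      obtain ⟨p, -, rfl⟩ := exists_chart_eq q
      have : p.1 = 1 := by
        change p.1 - 1 = 0 at hq
        linarith
      refine Subtype.ext (Prod.ext this ?_)
      simp [chart, this]
    have hne : ∀ q, k q ≠ 0 → h q ≠ h (chart (1, 0)) := by
      intro q hq hqr
      rw [h.injective hqr] at hq
      exact hq (by simp [k, chart])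
    have := pos_iff_of_prod (k := k ∘ h.symm) (hk.comp h.symm.continuous) (p := h (chart (1, 0)))
      (fun q hq => by rw [← h0 _ hq]; simp) (hne (chart (0, 0)) (by simp [k, chart]))
      (hne (chart (2, 0)) (by norm_num [k, chart]))
    norm_num [k, chart] at this

/-! ### The measure in coordinates -/

/-- The uniform probability measure on `[-1, 1]`. -/
noncomputable def uniformMeasure : Measure ℝ :=
  ENNReal.ofReal (1 / 2) • volume.restrict (Set.Icc (-1) 1)

instance : IsProbabilityMeasure uniformMeasure := ⟨by
  simp only [uniformMeasure, Measure.smul_apply, Measure.restrict_apply_univ, Real.volume_Icc,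
    smul_eq_mul]
  rw [← ENNReal.ofReal_mul (by norm_num)]
  norm_num⟩

/-- The measure of `ConeLine` in the coordinates of `chart`. -/
noncomputable def stripMeasure : Measure (ℝ × ℝ) := volume.prod uniformMeasure

theorem map_volume_affine (a : ℝ) {b : ℝ} (hb : b ≠ 0) :
    (volume : Measure ℝ).map (fun x => a + b * x) = ENNReal.ofReal |b⁻¹| • volume := by
  have : (fun x : ℝ => a + b * x) = (fun x => a + x) ∘ (fun x => b * x) := rfl
  rw [this, ← Measure.map_map (by fun_prop) (by fun_prop), Real.map_volume_mul_left hb,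
    Measure.map_smul, map_add_left_eq_self]

theorem volume_preimage_affine (a : ℝ) {b : ℝ} (hb : b ≠ 0) {s : Set ℝ} (hs : MeasurableSet s) :
    volume ((fun x => a + b * x) ⁻¹' s) = ENNReal.ofReal |b⁻¹| * volume s := by
  rw [← Measure.map_apply (by fun_prop) hs, map_volume_affine a hb]
  rfl

theorem uniformMeasure_apply {s : Set ℝ} (hs : MeasurableSet s) :
    uniformMeasure s = ENNReal.ofReal (1 / 2) * volume (s ∩ Set.Icc (-1) 1) := by
  simp [uniformMeasure, Measure.restrict_apply hs]

theorem ae_abs_snd_le_one : ∀ᵐ p ∂stripMeasure, |p.2| ≤ 1 := by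
  have h : ∀ᵐ η ∂uniformMeasure, |η| ≤ 1 := by
    refine Measure.ae_smul_measure ?_ _
    filter_upwards [ae_restrict_mem measurableSet_Icc] with η hη using abs_le.2 hη
  exact Measure.quasiMeasurePreserving_snd.ae h

theorem stripMeasure_apply {s : Set (ℝ × ℝ)} (hs : MeasurableSet s) :
    stripMeasure s = ∫⁻ x, uniformMeasure (Prod.mk x ⁻¹' s) :=
  Measure.prod_apply hs

theorem hausdorffMeasure_halfLine_apply {s : Set (ℝ × ℝ)} (hs : MeasurableSet s) :
    (Measure.hausdorffMeasure 1).restrict halfLine s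
      = ∫⁻ x : ℝ, (Set.Ici 0 ∩ (fun x : ℝ => (x, (0 : ℝ))) ⁻¹' s).indicator 1 x := by
  have hi : Isometry (fun x : ℝ => (x, (0 : ℝ))) := Isometry.of_dist_eq fun x y => by
    simp [Prod.dist_eq]
  have hm : Measurable (fun x : ℝ => (x, (0 : ℝ))) := hi.continuous.measurable
  have hr : s ∩ halfLine = (s ∩ halfLine) ∩ Set.range (fun x : ℝ => (x, (0 : ℝ))) := by
    refine (Set.inter_eq_left.2 ?_).symm
    rintro p ⟨-, -, hp⟩
    exact ⟨p.1, Prod.ext rfl hp.symm⟩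
  have hsl := hs.inter isClosed_halfLine.measurableSet
  rw [lintegral_indicator_one (measurableSet_Ici.inter (hm hs)), Measure.restrict_apply hs, hr,
    ← Measure.restrict_apply hsl, ← hi.map_hausdorffMeasure (Or.inl zero_le_one),
    Measure.map_apply hm hsl, hausdorffMeasure_real]
  congr 1
  ext x
  simp [halfLine, and_comm]

theorem cone_part_apply {s : Set (ℝ × ℝ)} (hs : MeasurableSet s) :
    ((volume.restrict planarCone).withDensity (fun p => ENNReal.ofReal (3 / (-2 * p.1)))) s
      = ∫⁻ x : ℝ, ENNReal.ofReal (3 / (-2 * x)) * volume (Prod.mk x ⁻¹' (s ∩ planarCone)) := by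
  have hC := isClosed_planarCone.measurableSet
  have hw : Measurable (fun p : ℝ × ℝ => ENNReal.ofReal (3 / (-2 * p.1))) := by fun_prop
  rw [withDensity_apply _ hs, Measure.restrict_restrict hs,
    ← lintegral_indicator (hs.inter hC), Measure.volume_eq_prod,
    lintegral_prod _ (hw.indicator (hs.inter hC)).aemeasurable]
  refine lintegral_congr fun x => ?_
  have hm : MeasurableSet (Prod.mk x ⁻¹' (s ∩ planarCone)) := measurable_prodMk_left (hs.inter hC)
  rw [← lintegral_indicator_one hm, ← lintegral_const_mul _ (measurable_one.indicator hm)]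
  refine lintegral_congr fun y => ?_
  by_cases h : (x, y) ∈ s ∩ planarCone
  · rw [Set.indicator_of_mem h, Set.indicator_of_mem (show y ∈ Prod.mk x ⁻¹' (s ∩ planarCone) from h)]
    simp
  · rw [Set.indicator_of_notMem h, Set.indicator_of_notMem (show y ∉ Prod.mk x ⁻¹' (s ∩ planarCone) from h)]
    simp

theorem slice_measure {s : Set (ℝ × ℝ)} (hs : MeasurableSet s) {x : ℝ} (hx : x < 0) :
    uniformMeasure (Prod.mk x ⁻¹' ((fun p => (chart p).1) ⁻¹' s))
      = ENNReal.ofReal (3 / (-2 * x)) * volume (Prod.mk x ⁻¹' (s ∩ planarCone)) := by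
  have hc : Measurable (fun p => (chart p).1) :=
    (continuous_subtype_val.comp continuous_chart).measurable
  have hb : (-x / 3) ≠ 0 := by
    have : 0 < -x / 3 := by linarith
    exact this.ne'
  have hset : Prod.mk x ⁻¹' ((fun p => (chart p).1) ⁻¹' s) ∩ Set.Icc (-1) 1
      = (fun η => 0 + -x / 3 * η) ⁻¹' (Prod.mk x ⁻¹' (s ∩ planarCone)) := by
    ext η
    have h1 : (x, 0 + -x / 3 * η) ∈ planarCone ↔ η ∈ Set.Icc (-1 : ℝ) 1 := by
      rw [Set.mem_Icc, ← abs_le]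
      simp only [planarCone, Set.mem_ofPred_eq, zero_add, abs_mul]
      rw [abs_of_pos (by linarith : (0 : ℝ) < -x / 3)]
      constructor <;> intro h <;> nlinarith
    simp only [Set.mem_inter_iff, Set.mem_preimage, h1]
    refine and_congr_left fun h => ?_
    have : (chart (x, η)).1 = (x, 0 + -x / 3 * η) := by
      refine Prod.ext rfl ?_
      simp only [chart, clampOne_of_abs_le (abs_le.2 h), max_eq_left (neg_pos.2 hx).le]
      ring
    rw [this]
  rw [uniformMeasure_apply (measurable_prodMk_left (hc hs)), hset, volume_preimage_affine _ hb
    (measurable_prodMk_left (hs.inter isClosed_planarCone.measurableSet)), ← mul_assoc,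
    ← ENNReal.ofReal_mul (by norm_num), abs_inv, abs_of_pos (by linarith : (0 : ℝ) < -x / 3)]
  congr 2
  have := hx.ne
  field_simp

theorem map_chart_val : stripMeasure.map (fun p => (chart p).1) = planeMeasure := by
  have hc : Measurable (fun p => (chart p).1) :=
    (continuous_subtype_val.comp continuous_chart).measurable
  ext s hs
  have hm : Measurable (fun x : ℝ => (x, (0 : ℝ))) := by fun_prop
  rw [Measure.map_apply hc hs, stripMeasure_apply (hc hs), planeMeasure, Measure.add_apply,
    cone_part_apply hs, hausdorffMeasure_halfLine_apply hs,
    ← lintegral_add_right _ (measurable_one.indicator (measurableSet_Ici.inter (hm hs)))]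
  refine lintegral_congr fun x => ?_
  rcases lt_or_ge x 0 with hx | hx
  · rw [slice_measure hs hx, Set.indicator_of_notMem (fun h => not_le.2 hx h.1), add_zero]
  -- The density vanishes here: `ofReal` truncates negative values, and at `x = 0` the quotient is
  -- `0` by convention.
  · have h0 : ENNReal.ofReal (3 / (-2 * x)) = 0 :=
      ENNReal.ofReal_eq_zero.2 (div_nonpos_of_nonneg_of_nonpos (by norm_num) (by linarith))
    have hch : ∀ η, (chart (x, η)).1 = (x, 0) := fun η => by simp [chart, hx]
    rw [h0, zero_mul, zero_add]
    by_cases h : (x, (0 : ℝ)) ∈ s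
    · have : Prod.mk x ⁻¹' ((fun p => (chart p).1) ⁻¹' s) = Set.univ := by
        ext η; simp [hch, h]
      have hx' : x ∈ Set.Ici (0 : ℝ) ∩ (fun x : ℝ => (x, (0 : ℝ))) ⁻¹' s := ⟨hx, h⟩
      rw [this, measure_univ, Set.indicator_of_mem hx']
      rfl
    · have : Prod.mk x ⁻¹' ((fun p => (chart p).1) ⁻¹' s) = ∅ := by
        ext η; simp [hch, h]
      rw [this, measure_empty, Set.indicator_of_notMem (fun h' => h h'.2)]

theorem map_chart : stripMeasure.map chart = coneLineMeasure := by
  have he : MeasurableEmbedding (Subtype.val : ConeLine → ℝ × ℝ) :=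
    MeasurableEmbedding.subtype_coe isClosed_coneLine.measurableSet
  have : (fun p => (chart p).1) = Subtype.val ∘ chart := rfl
  rw [coneLineMeasure, ← map_chart_val, this,
    ← Measure.map_map he.measurable continuous_chart.measurable, he.comap_map]

theorem coneLineMeasure_apply {s : Set ConeLine} (hs : MeasurableSet s) :
    coneLineMeasure s = stripMeasure (chart ⁻¹' s) := by
  rw [← map_chart, Measure.map_apply continuous_chart.measurable hs]

/-! ### Measure of balls -/

theorem coneLineMeasure_ball_lt_top (q : ConeLine) (r : ℝ) :
    coneLineMeasure (Metric.ball q r) < ⊤ := by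
  rw [coneLineMeasure_apply Metric.isOpen_ball.measurableSet]
  have hsub : chart ⁻¹' Metric.ball q r ⊆ Metric.ball q.1.1 r ×ˢ Set.univ := by
    intro p hp
    refine ⟨?_, Set.mem_univ _⟩
    rw [Set.mem_preimage, Metric.mem_ball, ConeLine.dist_eq] at hp
    exact (le_max_left _ _).trans_lt hp
  refine (measure_mono hsub).trans_lt ?_
  rw [stripMeasure, Measure.prod_prod, measure_univ, mul_one]
  exact measure_ball_lt_top

theorem stripMeasure_pos {U : Set (ℝ × ℝ)} (hU : IsOpen U) {p : ℝ × ℝ} (hp : p ∈ U)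
    (h : |p.2| ≤ 1) : 0 < stripMeasure U := by
  obtain ⟨u, v, hu, hv, h1, h2, huv⟩ := isOpen_prod_iff.1 hU p.1 p.2 hp
  refine lt_of_lt_of_le ?_ (measure_mono huv)
  rw [stripMeasure, Measure.prod_prod, uniformMeasure_apply hv.measurableSet]
  refine ENNReal.mul_pos (hu.measure_pos _ ⟨_, h1⟩).ne' (mul_ne_zero (by simp) ?_)
  -- The point may have `|η| = 1`, but an open set around it still meets the open interval.
  have hcl : p.2 ∈ closure (Set.Ioo (-1 : ℝ) 1) := by
    rw [closure_Ioo (by norm_num)]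
    exact abs_le.1 h
  refine (lt_of_lt_of_le ((hv.inter isOpen_Ioo).measure_pos volume
    (mem_closure_iff.1 hcl v hv h2)) (measure_mono ?_)).ne'
  exact Set.inter_subset_inter_right _ Set.Ioo_subset_Icc_self

theorem coneLineMeasure_ball_pos (q : ConeLine) {r : ℝ} (hr : 0 < r) :
    0 < coneLineMeasure (Metric.ball q r) := by
  rw [coneLineMeasure_apply Metric.isOpen_ball.measurableSet]
  obtain ⟨p, hp, rfl⟩ := exists_chart_eq q
  exact stripMeasure_pos (Metric.isOpen_ball.preimage continuous_chart)
    (Metric.mem_ball_self hr) hp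

/-! ### Contractions and the measure -/

/-- The point at time `t` between `p` and `q`, where the second coordinate moves with weight `f`. -/
def contraction (p : ℝ × ℝ) (t f : ℝ) (q : ℝ × ℝ) : ℝ × ℝ :=
  ((1 - t) * p.1 + t * q.1, (1 - f) * p.2 + f * q.2)

theorem abs_contraction_snd_le {p q : ℝ × ℝ} {t f : ℝ} (hp : |p.2| ≤ 1) (hq : |q.2| ≤ 1)
    (h0 : 0 ≤ f) (h1 : f ≤ 1) : |(contraction p t f q).2| ≤ 1 := by
  rw [abs_le] at *
  simp only [contraction]
  constructor <;> nlinarith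

/-- The affine map sends `[-1,1]` into itself and scales length by `f ≥ c`. -/
theorem uniformMeasure_preimage_le {η f c : ℝ} (hη : |η| ≤ 1) (hc : 0 < c) (hf : c ≤ f)
    (hf1 : f ≤ 1) {s : Set ℝ} (hs : MeasurableSet s) :
    ENNReal.ofReal c * uniformMeasure ((fun y => (1 - f) * η + f * y) ⁻¹' s)
      ≤ uniformMeasure s := by
  have hf0 : 0 < f := hc.trans_le hf
  have hm : Measurable (fun y : ℝ => (1 - f) * η + f * y) := by fun_prop
  rw [uniformMeasure_apply hs, uniformMeasure_apply (hm hs), mul_left_comm]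
  gcongr
  have hsub : (fun y => (1 - f) * η + f * y) ⁻¹' s ∩ Set.Icc (-1) 1
      ⊆ (fun y => (1 - f) * η + f * y) ⁻¹' (s ∩ Set.Icc (-1) 1) := by
    rintro y ⟨h1, h2⟩
    exact ⟨h1, abs_le.1 (abs_contraction_snd_le (p := (0, η)) (q := (0, y)) (t := 0) hη
      (abs_le.2 h2) hf0.le hf1)⟩
  calc ENNReal.ofReal c * volume ((fun y => (1 - f) * η + f * y) ⁻¹' s ∩ Set.Icc (-1) 1)
      ≤ ENNReal.ofReal c * (ENNReal.ofReal |f⁻¹| * volume (s ∩ Set.Icc (-1) 1)) := by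
        rw [← volume_preimage_affine _ hf0.ne' (hs.inter measurableSet_Icc)]
        gcongr
    _ = ENNReal.ofReal (c * |f⁻¹|) * volume (s ∩ Set.Icc (-1) 1) := by
        rw [← mul_assoc, ENNReal.ofReal_mul hc.le]
    _ ≤ 1 * volume (s ∩ Set.Icc (-1) 1) := by
        gcongr
        rw [ENNReal.ofReal_le_one, abs_inv, abs_of_pos hf0, ← div_eq_mul_inv]
        exact (div_le_one hf0).2 hf
    _ = _ := one_mul _

/-- Since `f` depends on the abscissa only, Fubini applies: the slices account for `t²` and the
abscissa for the remaining `t`. -/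
theorem map_contraction_le {p : ℝ × ℝ} (hp : |p.2| ≤ 1) {t : ℝ} (ht : 0 < t) {f : ℝ → ℝ}
    (hf : Measurable f) (hft : ∀ x, t ^ 2 ≤ f x) (hf1 : ∀ x, f x ≤ 1) :
    ENNReal.ofReal (t ^ 3) • stripMeasure.map (fun q => contraction p t (f q.1) q)
      ≤ stripMeasure := by
  have hm : Measurable (fun q => contraction p t (f q.1) q) := by
    unfold contraction
    fun_prop
  refine Measure.le_iff.2 fun s hs => ?_
  have hG : Measurable fun x => uniformMeasure (Prod.mk x ⁻¹' s) := measurable_measure_prodMk_left hs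
  rw [Measure.smul_apply, Measure.map_apply hm hs, stripMeasure_apply (hm hs),
    stripMeasure_apply hs, smul_eq_mul, pow_succ' t 2, ENNReal.ofReal_mul ht.le, mul_assoc,
    ← lintegral_const_mul _ (measurable_measure_prodMk_left (hm hs))]
  calc _ ≤ ENNReal.ofReal t * ∫⁻ x, uniformMeasure (Prod.mk ((1 - t) * p.1 + t * x) ⁻¹' s) := by
        gcongr with x
        exact uniformMeasure_preimage_le hp (by positivity) (hft x) (hf1 x)
          (measurable_prodMk_left hs)
    _ = ENNReal.ofReal t * ∫⁻ x, uniformMeasure (Prod.mk x ⁻¹' s)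
          ∂((volume : Measure ℝ).map (fun x => (1 - t) * p.1 + t * x)) := by
        rw [lintegral_map hG (by fun_prop)]
    _ = _ := by
        rw [map_volume_affine _ ht.ne', lintegral_smul_measure, smul_eq_mul, ← mul_assoc,
          ← ENNReal.ofReal_mul ht.le, abs_inv, abs_of_pos ht, mul_inv_cancel₀ ht.ne',
          ENNReal.ofReal_one, one_mul]

/-! ### Geodesics with affine abscissa -/

/-- The ordinate of `chart p` when `|p.2| ≤ 1`. -/
noncomputable def height (p : ℝ × ℝ) : ℝ := max (-p.1) 0 * p.2 / 3

theorem dist_chart {p q : ℝ × ℝ} (hp : |p.2| ≤ 1) (hq : |q.2| ≤ 1) :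
    dist (chart p) (chart q) = max |p.1 - q.1| |height p - height q| := by
  simp only [ConeLine.dist_eq, chart, height, clampOne_of_abs_le hp, clampOne_of_abs_le hq]

theorem contraction_fst_sub (p q : ℝ × ℝ) (s t f g : ℝ) :
    |(contraction p s f q).1 - (contraction p t g q).1| = |s - t| * |q.1 - p.1| := by
  rw [← abs_mul]
  congr 1
  simp only [contraction]
  ring

theorem height_contraction (p q : ℝ × ℝ) (t f : ℝ) :
    height (contraction p t f q)
      = max (-p.1 - t * (q.1 - p.1)) 0 * ((1 - f) * p.2 + f * q.2) / 3 := by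
  simp only [height, contraction]
  congr 3
  ring

/-- Paths of `ConeLine` that are straight in the plane are geodesics. -/
theorem dist_chart_of_height_affine {p q : ℝ × ℝ} (hp : |p.2| ≤ 1) (hq : |q.2| ≤ 1) {f : ℝ → ℝ}
    (hf0 : ∀ t ∈ unitInterval, 0 ≤ f t) (hf1 : ∀ t ∈ unitInterval, f t ≤ 1)
    (h : ∀ t ∈ unitInterval, height (contraction p t (f t) q)
      = (1 - t) * height p + t * height q) :
    ∃ D, ∀ s ∈ unitInterval, ∀ t ∈ unitInterval,
      dist (chart (contraction p s (f s) q)) (chart (contraction p t (f t) q)) = |s - t| * D := by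
  refine ⟨max |q.1 - p.1| |height q - height p|, fun s hs t ht => ?_⟩
  rw [dist_chart (abs_contraction_snd_le hp hq (hf0 s hs) (hf1 s hs))
    (abs_contraction_snd_le hp hq (hf0 t ht) (hf1 t ht)), contraction_fst_sub, h s hs, h t ht,
    mul_max_of_nonneg _ _ (abs_nonneg _), ← abs_mul (s - t) (height q - height p)]
  congr 2
  ring

/-- Paths of `ConeLine` with affine abscissa and a slope of absolute value at most one are
geodesics. -/
theorem dist_chart_of_height_lipschitz {p q : ℝ × ℝ} (hp : |p.2| ≤ 1) (hq : |q.2| ≤ 1) {f : ℝ → ℝ}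
    (hf0 : ∀ t ∈ unitInterval, 0 ≤ f t) (hf1 : ∀ t ∈ unitInterval, f t ≤ 1)
    (h : ∀ s ∈ unitInterval, ∀ t ∈ unitInterval, s ≤ t →
      |height (contraction p s (f s) q) - height (contraction p t (f t) q)|
        ≤ (t - s) * |q.1 - p.1|) :
    ∃ D, ∀ s ∈ unitInterval, ∀ t ∈ unitInterval,
      dist (chart (contraction p s (f s) q)) (chart (contraction p t (f t) q)) = |s - t| * D := by
  refine ⟨|q.1 - p.1|, fun s hs t ht => ?_⟩
  rw [dist_chart (abs_contraction_snd_le hp hq (hf0 s hs) (hf1 s hs))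
    (abs_contraction_snd_le hp hq (hf0 t ht) (hf1 t ht)), contraction_fst_sub]
  refine max_eq_left ?_
  rcases le_total s t with hst | hst
  · rw [abs_sub_comm s t, abs_of_nonneg (sub_nonneg.2 hst)]
    exact h s hs t ht hst
  · rw [abs_sub_comm (height _), abs_of_nonneg (sub_nonneg.2 hst)]
    exact h t ht s hs hst

/-- The difference is linear in `ξ` and `η`, so it suffices to bound the sum of the absolute values
of the coefficients. The only nontrivial case is `a f < b g`, where the bound `3 (a - b)` is exactly
hypothesis `h`; the `3` is the opening of the cone. -/
theorem abs_height_sub_le_of_antitone {a b f g ξ η : ℝ} (hξ : |ξ| ≤ 1) (hη : |η| ≤ 1)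
    (hb : 0 ≤ b) (hba : b ≤ a) (hfg : f ≤ g) (hf : 0 ≤ f) (hg : g ≤ 1)
    (h : b * (1 + g) ≤ a * (1 + f)) :
    |a * ((1 - f) * ξ + f * η) / 3 - b * ((1 - g) * ξ + g * η) / 3| ≤ a - b := by
  have key : |a * (1 - f) - b * (1 - g)| + |a * f - b * g| ≤ 3 * (a - b) := by
    have h1 : 0 ≤ a * (g - f) := mul_nonneg (hb.trans hba) (sub_nonneg.2 hfg)
    have h2 : 0 ≤ (a - b) * g := mul_nonneg (sub_nonneg.2 hba) (hf.trans hfg)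
    have h3 : 0 ≤ (a - b) * (1 - g) := mul_nonneg (sub_nonneg.2 hba) (sub_nonneg.2 hg)
    rcases abs_cases (a * (1 - f) - b * (1 - g)) with h4 | h4 <;>
      rcases abs_cases (a * f - b * g) with h5 | h5 <;> nlinarith
  have h1 : a * ((1 - f) * ξ + f * η) / 3 - b * ((1 - g) * ξ + g * η) / 3
      = ((a * (1 - f) - b * (1 - g)) * ξ + (a * f - b * g) * η) / 3 := by ring
  rw [h1, abs_div, abs_of_pos (zero_lt_three (α := ℝ)), div_le_iff₀ zero_lt_three]
  refine (abs_add_le _ _).trans ?_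
  rw [abs_mul, abs_mul]
  have := mul_le_mul_of_nonneg_left hξ (abs_nonneg (a * (1 - f) - b * (1 - g)))
  have := mul_le_mul_of_nonneg_left hη (abs_nonneg (a * f - b * g))
  linarith

/-- The quotient `(c - tK)/(2 - t)` is nonincreasing exactly when `c ≤ 2K`. As `1 + t/(2-t) =
2/(2-t)`, this supplies hypothesis `h` of `abs_height_sub_le_of_antitone` for the frozen weight. -/
theorem max_sub_mul_two_sub_le {c K s t : ℝ} (hK : c ≤ 2 * K) (hst : s ≤ t)
    (ht : t ≤ 1) : max (c - t * K) 0 * (2 - s) ≤ max (c - s * K) 0 * (2 - t) := by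
  rcases le_total (c - t * K) 0 with h | h
  · rw [max_eq_right h, zero_mul]
    exact mul_nonneg (le_max_right _ _) (by linarith)
  · rw [max_eq_left h]
    refine le_trans ?_ (mul_le_mul_of_nonneg_right (le_max_left (c - s * K) 0) (by linarith))
    nlinarith [mul_nonneg (sub_nonneg.2 hst) (sub_nonneg.2 hK)]

theorem max_sub_max_le {c K s t : ℝ} (hK : 0 ≤ K) (hst : s ≤ t) :
    max (c - t * K) 0 ≤ max (c - s * K) 0 ∧
      max (c - s * K) 0 - max (c - t * K) 0 ≤ (t - s) * K := by
  have h : 0 ≤ (t - s) * K := mul_nonneg (sub_nonneg.2 hst) hK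
  constructor
  · exact max_le_max (by linarith) le_rfl
  · rw [sub_le_iff_le_add]
    refine max_le ?_ ?_
    · linarith [le_max_left (c - t * K) 0]
    · linarith [le_max_right (c - t * K) 0]

/-! ### The choice of weight -/

/-- The weight of the geodesics from abscissa `a < 0` to abscissa `x`. -/
noncomputable def weight (a x t : ℝ) : ℝ :=
  t * max (-x) (-a / 2) / ((1 - t) * (-a) + t * max (-x) (-a / 2))

theorem weight_denom_pos {a : ℝ} (ha : a < 0) (x : ℝ) {t : ℝ} (ht : t ∈ unitInterval) :
    0 < (1 - t) * (-a) + t * max (-x) (-a / 2) := by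
  have h : -a / 2 ≤ max (-x) (-a / 2) := le_max_right _ _
  have := mul_le_mul_of_nonneg_left h ht.1
  have := mul_le_mul_of_nonneg_right ht.2 (neg_pos.2 ha).le
  linarith

theorem weight_le_one {a : ℝ} (ha : a < 0) (x : ℝ) {t : ℝ} (ht : t ∈ unitInterval) : weight a x t ≤ 1 := by
  rw [weight, div_le_one (weight_denom_pos ha x ht)]
  have := mul_nonneg (sub_nonneg.2 ht.2) (neg_pos.2 ha).le
  linarith

theorem sq_le_weight {a : ℝ} (ha : a < 0) (x : ℝ) {t : ℝ} (ht : t ∈ unitInterval) : t ^ 2 ≤ weight a x t := by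
  rw [weight, le_div_iff₀ (weight_denom_pos ha x ht)]
  have h : -a / 2 ≤ max (-x) (-a / 2) := le_max_right _ _
  obtain ⟨h0, h1⟩ := ht
  set v := max (-x) (-a / 2)
  -- As `-a ≤ 2v`, the left side is at most `(2t - t²) v = (1 - (1-t)²) v`.
  have key : t * ((1 - t) * (-a) + t * v) ≤ v := by
    nlinarith [mul_nonneg h0 (sub_nonneg.2 h1), mul_nonneg (sub_nonneg.2 h1) (sub_nonneg.2 h1),
      mul_nonneg (mul_nonneg h0 (sub_nonneg.2 h1)) (sub_nonneg.2 h)]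
  nlinarith

theorem weight_nonneg {a : ℝ} (ha : a < 0) (x : ℝ) {t : ℝ} (ht : t ∈ unitInterval) : 0 ≤ weight a x t :=
  (sq_nonneg t).trans (sq_le_weight ha x ht)

theorem weight_of_le {a : ℝ} (ha : a < 0) {x t : ℝ} (hx : a / 2 ≤ x) : weight a x t = t / (2 - t) := by
  rw [weight, max_eq_right (by linarith)]
  have h2 : (1 - t) * -a + t * (-a / 2) = (2 - t) * (-a / 2) := by ring
  rw [h2, mul_div_mul_right _ _ (by linarith : (0 : ℝ) < -a / 2).ne']

/-- For `q.1 ≤ a/2` the weight is that of the straight segment; beyond `a/2` it is `t/(2-t)` and the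
slope bound applies. -/
theorem weight_geodesic {a : ℝ} (ha : a < 0) {p q : ℝ × ℝ} (hpa : p.1 = a) (hp : |p.2| ≤ 1) (hq : |q.2| ≤ 1) :
    ∃ D, ∀ s ∈ unitInterval, ∀ t ∈ unitInterval,
      dist (chart (contraction p s (weight a q.1 s) q))
        (chart (contraction p t (weight a q.1 t) q)) = |s - t| * D := by
  subst hpa
  rcases le_total (p.1 / 2) q.1 with hx | hx
  · refine dist_chart_of_height_lipschitz hp hq (fun t ht => weight_nonneg ha _ ht)
      (fun t ht => weight_le_one ha _ ht) fun s hs t ht hst => ?_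
    have hK : 0 ≤ q.1 - p.1 := by linarith
    rw [height_contraction, height_contraction, abs_of_nonneg hK]
    obtain ⟨h1, h2⟩ := max_sub_max_le (c := -p.1) hK hst
    have h2s : 0 < 2 - s := by linarith [hs.2]
    have h2t : 0 < 2 - t := by linarith [ht.2]
    refine (abs_height_sub_le_of_antitone hp hq (le_max_right _ _) h1 ?_ (weight_nonneg ha _ hs)
      (weight_le_one ha _ ht) ?_).trans h2
    · rw [weight_of_le ha hx, weight_of_le ha hx, div_le_div_iff₀ h2s h2t]
      nlinarith
    · have h3 := max_sub_mul_two_sub_le (c := -p.1) (K := q.1 - p.1) (by linarith) hst ht.2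
      have e : ∀ r : ℝ, 0 < 2 - r → 1 + r / (2 - r) = 2 / (2 - r) := fun r hr => by
        field_simp; ring
      rw [weight_of_le ha hx, weight_of_le ha hx, e s h2s, e t h2t, ← mul_div_assoc,
        ← mul_div_assoc, div_le_div_iff₀ h2t h2s]
      linarith
  · refine dist_chart_of_height_affine hp hq (fun t ht => weight_nonneg ha _ ht)
      (fun t ht => weight_le_one ha _ ht) fun t ht => ?_
    have hd := weight_denom_pos ha q.1 ht
    rw [height_contraction, height, height, weight]
    rw [max_eq_left (by linarith : -p.1 / 2 ≤ -q.1)] at hd ⊢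
    rw [max_eq_left (by linarith : 0 ≤ -p.1 - t * (q.1 - p.1)), max_eq_left (by linarith : 0 ≤ -p.1),
      max_eq_left (by linarith : 0 ≤ -q.1)]
    have e : -p.1 - t * (q.1 - p.1) = (1 - t) * -p.1 + t * -q.1 := by ring
    rw [e]
    have hd' := hd.ne'
    generalize hD : (1 - t) * -p.1 + t * -q.1 = d at hd'
    have e2 : 1 - t * -q.1 / d = (1 - t) * -p.1 / d := by
      rw [eq_div_iff hd', sub_mul, div_mul_cancel₀ _ hd', ← hD]
      ring
    rw [e2]
    field_simp

/-! ### The geodesics issuing from a point -/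

/-- Every point of `ConeLine` is joined to all points by a continuous family of geodesics, along
which the slices of the cone contract at most quadratically. -/
theorem exists_weight (x₀ : ConeLine) : ∃ (p : ℝ × ℝ) (f : ℝ × unitInterval → ℝ),
    |p.2| ≤ 1 ∧ Continuous f ∧ (∀ x (t : unitInterval), (t : ℝ) ^ 2 ≤ f (x, t) ∧ f (x, t) ≤ 1) ∧
    ∀ q : ℝ × ℝ, |q.2| ≤ 1 →
      chart (contraction p 0 (f (q.1, 0)) q) = x₀ ∧
      chart (contraction p 1 (f (q.1, 1)) q) = chart q ∧
      ∀ s t : unitInterval, dist (chart (contraction p s (f (q.1, s)) q))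
        (chart (contraction p t (f (q.1, t)) q)) = |(s : ℝ) - t|
          * dist (chart (contraction p 0 (f (q.1, 0)) q))
            (chart (contraction p 1 (f (q.1, 1)) q)) := by
  obtain ⟨p, hp, rfl⟩ := exists_chart_eq x₀
  have of_exists : ∀ (f : ℝ → ℝ) (q : ℝ × ℝ), (∃ D, ∀ s ∈ unitInterval, ∀ t ∈ unitInterval,
      dist (chart (contraction p s (f s) q)) (chart (contraction p t (f t) q)) = |s - t| * D) →
      ∀ s t : unitInterval, dist (chart (contraction p s (f s) q))
        (chart (contraction p t (f t) q)) = |(s : ℝ) - t|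
          * dist (chart (contraction p 0 (f 0) q)) (chart (contraction p 1 (f 1) q)) := by
    rintro f q ⟨D, hD⟩ s t
    rw [hD 0 unitInterval.zero_mem 1 unitInterval.one_mem, hD s s.2 t t.2]
    simp
  rcases lt_or_ge p.1 0 with ha | ha
  · refine ⟨p, fun z => weight p.1 z.1 z.2, hp, ?_, fun x t =>
      ⟨sq_le_weight ha x t.2, weight_le_one ha x t.2⟩, fun q hq => ⟨?_, ?_, ?_⟩⟩
    · unfold weight
      refine Continuous.div (by fun_prop) (by fun_prop) fun z => (weight_denom_pos ha z.1 z.2.2).ne'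
    · simp [weight, contraction]
    · have h := weight_denom_pos ha q.1 unitInterval.one_mem
      simp only [sub_self, zero_mul, one_mul, zero_add] at h
      simp [weight, contraction, div_self h.ne']
    · simpa only [Set.Icc.coe_zero, Set.Icc.coe_one] using
        of_exists (weight p.1 q.1) q (weight_geodesic ha rfl hp hq)
  -- Over `L` all values of `η` give the same point, so `η` may equal its final value from the
  -- start; the slope is then at most `1/3`.
  · refine ⟨p, fun _ => 1, hp, continuous_const, fun x t =>
      ⟨pow_le_one₀ t.2.1 t.2.2, le_rfl⟩, fun q hq => ⟨?_, ?_, ?_⟩⟩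
    · simp [contraction, chart, ha]
    · simp [contraction]
    · suffices h : ∀ s ∈ unitInterval, ∀ t ∈ unitInterval, s ≤ t →
          |height (contraction p s 1 q) - height (contraction p t 1 q)| ≤ (t - s) * |q.1 - p.1| from
        of_exists (fun _ => 1) q (dist_chart_of_height_lipschitz (f := fun _ => 1) hp hq
          (fun _ _ => zero_le_one) (fun _ _ => le_rfl) h)
      intro s hs t ht hst
      rw [height_contraction, height_contraction, ← sub_div, ← sub_mul, abs_div, abs_mul,
        abs_of_pos (zero_lt_three (α := ℝ)), div_le_iff₀ zero_lt_three]
      have h1 : |(1 - 1) * p.2 + 1 * q.2| ≤ 1 := by simpa using hq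
      have h2 : |max (-p.1 - s * (q.1 - p.1)) 0 - max (-p.1 - t * (q.1 - p.1)) 0|
          ≤ (t - s) * |q.1 - p.1| := by
        refine (abs_max_sub_max_le_abs _ _ _).trans (le_of_eq ?_)
        rw [← abs_of_nonneg (sub_nonneg.2 hst), ← abs_mul]
        congr 1
        ring
      have h3 := mul_le_mul_of_nonneg_left h1
        (abs_nonneg (max (-p.1 - s * (q.1 - p.1)) 0 - max (-p.1 - t * (q.1 - p.1)) 0))
      nlinarith [abs_nonneg (q.1 - p.1), mul_nonneg (sub_nonneg.2 hst) (abs_nonneg (q.1 - p.1))]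

theorem chart_clampOne (q : ℝ × ℝ) : chart (q.1, clampOne q.2) = chart q := by
  simp only [chart, clampOne_of_abs_le (abs_clampOne_le q.2)]

/-- The contraction of `ConeLine` to a point by a continuous family of geodesics, with its effect
on the reference measure. -/
theorem exists_geodesic_family (x₀ : ConeLine) : ∃ G : ℝ × ℝ → Geo ConeLine, Continuous G ∧
    (∀ q, Geo.eval 0 (G q) = x₀) ∧ (∀ q, Geo.eval 1 (G q) = chart q) ∧
    ∀ t : unitInterval, ENNReal.ofReal ((t : ℝ) ^ 3) • stripMeasure.map (fun q => Geo.eval t (G q))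
      ≤ coneLineMeasure := by
  obtain ⟨p, f, hp, hf, hft, hG⟩ := exists_weight x₀
  have hc := continuous_chart
  have hcl := continuous_clampOne
  -- Truncating `η` defines the family on the whole plane, and currying makes it continuous for
  -- uniform convergence.
  let F : C((ℝ × ℝ) × unitInterval, ConeLine) :=
    ⟨fun z => chart (contraction p z.2 (f (z.1.1, z.2)) (z.1.1, clampOne z.1.2)), by
      unfold contraction
      fun_prop⟩
  have hq : ∀ q : ℝ × ℝ, |((q.1, clampOne q.2) : ℝ × ℝ).2| ≤ 1 := fun q => abs_clampOne_le q.2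
  refine ⟨fun q => ⟨F.curry q, (hG _ (hq q)).2.2⟩, F.curry.continuous.subtype_mk _,
    fun q => (hG _ (hq q)).1, fun q => (hG _ (hq q)).2.1.trans (chart_clampOne q), fun t => ?_⟩
  rcases t.2.1.eq_or_lt with ht | ht
  · rw [← ht]
    simpa using Measure.zero_le coneLineMeasure
  have hm : Measurable fun q : ℝ × ℝ => contraction p t (f (q.1, t)) q := by
    unfold contraction
    fun_prop
  have hae : (fun q : ℝ × ℝ => F (q, t)) =ᵐ[stripMeasure]
      chart ∘ fun q => contraction p t (f (q.1, t)) q := by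
    filter_upwards [ae_abs_snd_le_one] with q hq
    change chart (contraction p t (f (q.1, t)) (q.1, clampOne q.2)) = _
    rw [clampOne_of_abs_le hq]
    rfl
  change ENNReal.ofReal ((t : ℝ) ^ 3) • stripMeasure.map (fun q => F (q, t)) ≤ _
  rw [Measure.map_congr hae, ← Measure.map_map hc.measurable hm, ← Measure.map_smul, ← map_chart]
  exact Measure.map_mono (map_contraction_le hp ht (f := fun x => f (x, t)) (by fun_prop)
    (fun x => (hft x t).1) (fun x => (hft x t).2)) hc.measurable

theorem isGeodesicSpace_coneLine : IsGeodesicSpace ConeLine := by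
  intro x y
  obtain ⟨G, -, h0, h1, -⟩ := exists_geodesic_family x
  obtain ⟨q, -, rfl⟩ := exists_chart_eq y
  exact ⟨G q, h0 q, h1 q⟩

/-! ### The measure contraction property -/

theorem distortion_zero_three (t d : ℝ) : distortion 0 3 t d = t ^ 3 := by
  have h : (3 : ℝ) - 1 = (2 : ℕ) := by norm_num
  rw [distortion, if_neg (by norm_num), h, Real.rpow_natCast, Real.rpow_natCast]
  split_ifs with hd
  · ring
  · have h2 : d / √((2 : ℕ) : ℝ) ≠ 0 := div_ne_zero hd (by simp)
    simp only [sK, lt_irrefl, if_false]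
    rw [mul_div_assoc, mul_div_cancel_right₀ _ h2]
    ring

theorem Geo.measurable_eval {X : Type*} [MetricSpace X] [MeasurableSpace X] [BorelSpace X]
    (t : unitInterval) : Measurable (Geo.eval t : Geo X → X) := by
  refine Continuous.measurable ?_
  unfold Geo.eval
  fun_prop

theorem mcp_coneLine : MCP 0 3 coneLineMeasure := by
  refine ⟨Or.inl (by norm_num), fun x A hA hA0 hAtop _ => ?_⟩
  obtain ⟨G, hG, h0, h1, hcontr⟩ := exists_geodesic_family x
  have hGm := hG.measurable
  have hev := Geo.measurable_eval (X := ConeLine)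
  have hcA := continuous_chart.measurable hA
  set M := coneLineMeasure A with hM
  have hmul : M * M⁻¹ = 1 := ENNReal.mul_inv_cancel hA0.ne' hAtop.ne
  have hone : M⁻¹ * M = 1 := ENNReal.inv_mul_cancel hA0.ne' hAtop.ne
  have hmass : stripMeasure.restrict (chart ⁻¹' A) Set.univ = M := by
    rw [Measure.restrict_apply_univ, hM, coneLineMeasure_apply hA]
  -- The plan is the normalized strip measure over `A`, carried to geodesics by `G`.
  refine ⟨M⁻¹ • (stripMeasure.restrict (chart ⁻¹' A)).map G, ⟨?_⟩, ?_, ?_, fun t => ?_⟩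
  · rw [Measure.smul_apply, Measure.map_apply hGm MeasurableSet.univ, Set.preimage_univ, hmass,
      smul_eq_mul, hone]
  · have : Geo.eval 0 ∘ G = fun _ => x := funext h0
    rw [Measure.map_smul, Measure.map_map (hev 0) hGm, this, Measure.map_const, hmass, smul_smul,
      hone, one_smul]
  · have : Geo.eval 1 ∘ G = chart := funext h1
    rw [Measure.map_smul, Measure.map_map (hev 1) hGm, this,
      ← Measure.restrict_map continuous_chart.measurable hA, map_chart]
  · simp only [distortion_zero_three]
    rw [withDensity_const, smul_smul, smul_smul, mul_comm M, mul_assoc, hmul, mul_one,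
      Measure.map_smul, Measure.map_map (hev t) hGm]
    refine le_trans ?_ (hcontr t)
    gcongr
    exact Measure.map_mono Measure.restrict_le_self ((hev t).comp hGm)

theorem mainTheorem2 :
    -- the metric is the `l^∞` metric of the plane
    (∀ p q : ConeLine, dist p q = max |p.1.1 - q.1.1| |p.1.2 - q.1.2|) ∧
    -- `X` is a complete geodesic metric measure space
    CompleteSpace ConeLine ∧
    TopologicalSpace.SeparableSpace ConeLine ∧
    IsGeodesicSpace ConeLine ∧
    (∀ (p : ConeLine) (r : ℝ), 0 < r →
      0 < coneLineMeasure (Metric.ball p r) ∧ coneLineMeasure (Metric.ball p r) < ⊤) ∧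
    -- it satisfies `MCP(0,3)`
    MCP 0 3 coneLineMeasure ∧
    -- it contains an isometric copy of the real line
    (∃ f : ℝ → ConeLine, Isometry f) ∧
    -- it does not split topologically
    ¬ TopologicallySplits ConeLine := by
  exact ⟨ConeLine.dist_eq, isClosed_coneLine.completeSpace_coe, inferInstance,
    isGeodesicSpace_coneLine,
    fun p _ hr => ⟨coneLineMeasure_ball_pos p hr, coneLineMeasure_ball_lt_top p _⟩,
    mcp_coneLine, exists_isometry_real_coneLine, not_topologicallySplits_coneLine⟩
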